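/- Let $q$ be a complex number with $0<|q|<1$. Write $(x;q)_\infty=\prod_{i\ge 0}(1-xq^i)$, $(q)_\infty=(q;q)_\infty$, and, for $x\neq 0$, $$\Theta(x;q)=(x;q)_\infty\,(q/x;q)_\infty\,(q;q)_\infty,\qquad \Theta_{a,m}=\Theta(q^a;q^m).$$ For positive integers $a,b,c$ with $b^2-ac>0$ and $x,y\neq 0$ let $$f_{a,b,c}(x,y;q)=\sum_{r,s\in\mathbb Z}\mathrm{sg}(r,s)\,(-1)^{r+s}x^ry^sq^{a\binom r2+brs+c\binom s2},$$ where $\mathrm{sg}(r,s)=\tfrac12(\mathrm{sg}(r)+\mathrm{sg}(s))$, with $\mathrm{sg}(r)=1$ for $r\ge 0$ and $\mathrm{sg}(r)=-1$ for $r<0$. For $z\neq 0$ with $\Theta(z;q)\ne 0$, and $x$ such that $q^{r-1}xz\neq 1$ for all $r\in\mathbb Z$, define the Appell function $$m(x,z;q)=\frac1{\Theta(z;q)}\sum_{r\in\mathbb Z}\frac{(-1)^rq^{\binom r2}z^r}{1-q^{r-1}xz}.$$ **Proposition.** Let $x$ be a nonzero complex number such that $\Theta(-x^3;q^3)\ne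 0$ and $\Theta(q^sx^4;q^4)\neq 0$ for $s\in\{0,1,3\}$. Then the double series $f_{1,2,3}(x^{-1}q^2,q^3;q)$ and the series of all Appell functions below converge absolutely, and $$\begin{aligned} f_{1,2,3}(x^{-1}q^2,q^3;q) ={}& x^{-1}m(x^{-3}q^2,-x^{3};q^{3})\,(q)_{\infty} + x^{-2}m(x^{-3}q,-x^{3};q^{3})\,(q)_{\infty} \\ & + x^{-1}\frac{\Theta_{6,12}\,\Theta(x^{4};q^{4})}{\Theta(-x^{3};q^{3})} \left[ x^{-2} m(-x^{-4}q, x^{4}; q^{4})- m(-x^{-4}q^3, x^{4}; q^{4})\right] \\ & - \frac{\Theta_{3,12}\,\Theta(qx^{4};q^{4})}{\Theta(-x^{3};q^{3})} \left[ x^{-2} m(-x^{-4}q, q x^{4}; q^{4})- m(-x^{-4}q^3, qx^{4}; q^{4})\right]\\ & - q^3x^{2}\,\frac{\Theta_{-3,12}\,\Theta(q^3x^{4};q^{4})}{\Theta(-x^{3};q^{3})}\left[ x^{-2}m(-x^{-4}q, q^3 x^{4}; q^{4})- m(-x^{-4}q^3, q^3 x^{4}; q^{4})\right]. \end{aligned}$$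 -/

import Mathlib

noncomputable section

namespace AppellForm

/-- The infinite `q`-Pochhammer symbol `(x;q)_∞ = ∏_{i ≥ 0} (1 - x q^i)`.
For `‖q‖ < 1` the product converges unconditionally. -/
def qPoch (x q : ℂ) : ℂ := ∏' i : ℕ, (1 - x * q ^ i)

/-- The theta function `Θ(x;q) = (x;q)_∞ (q/x;q)_∞ (q;q)_∞`. -/
def Theta (x q : ℂ) : ℂ := qPoch x q * qPoch (q / x) q * qPoch q q

/-- The binomial coefficient `r(r-1)/2` of an integer `r` (the division is exact). -/
def binom2 (r : ℤ) : ℤ := r * (r - 1) / 2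

/-- The sign of an integer, with value `1` at `0`. -/
def sg (r : ℤ) : ℤ := if 0 ≤ r then 1 else -1

/-- `sg(r,s) = (sg(r) + sg(s))/2`, which is `1`, `-1` or `0` (the division is exact). -/
def sg₂ (r s : ℤ) : ℤ := (sg r + sg s) / 2

/-- The term of index `p = (r,s)` of the Hecke-type double sum `f_{a,b,c}(x,y;q)`. -/
def heckeTerm (a b c : ℤ) (x y q : ℂ) (p : ℤ × ℤ) : ℂ :=
  (sg₂ p.1 p.2 : ℂ) * (-1) ^ (p.1 + p.2) * x ^ p.1 * y ^ p.2 *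
    q ^ (a * binom2 p.1 + b * p.1 * p.2 + c * binom2 p.2)

/-- The Hecke-type double sum `f_{a,b,c}(x,y;q)`. -/
def hecke (a b c : ℤ) (x y q : ℂ) : ℂ := ∑' p : ℤ × ℤ, heckeTerm a b c x y q p

/-- The `r`-th term of the bilateral series in the Appell function `m(x,z;q)`. -/
def appellTerm (x z q : ℂ) (r : ℤ) : ℂ :=
  (-1) ^ r * q ^ binom2 r * z ^ r / (1 - q ^ (r - 1) * x * z)

/-- The Appell function
`m(x,z;q) = Θ(z;q)⁻¹ ∑_{r ∈ ℤ} (-1)^r q^{r(r-1)/2} z^r / (1 - q^{r-1} x z)`. -/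
def appell (x z q : ℂ) : ℂ := (Theta z q)⁻¹ * ∑' r : ℤ, appellTerm x z q r

end AppellForm

end

namespace AppellForm
open Filter Topology

/-! Multiply the double sum by the series of $\Theta(-x^3;q^3)$, with summation index $t$, and
collect powers of $x$. With $n=3t-r$ and $u=s+2t$, moving $t$ at fixed $n,u$ shifts $(r,s,t)$ by
$(3,-2,1)$, an isotropic direction of the total form $r^2+4rs+3s^2+3t^2$. So for fixed $n$ the
summand is a theta term in $u$ times $(-q^n)^t$ (`heckeTerm_mul_thetaTerm`). The sign factor
restricts $t$ to a signed interval from $\lceil n/3\rceil$ to $\lfloor u/2\rfloor$, and the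
geometric sum leaves two endpoint terms over $1+q^n$.

Summed over $u$, the lower endpoint gives $\Theta(q^{3-2n};q^3)$, which is zero if $3\mid n$ and a
monomial times $(q)_\infty$ otherwise. The upper endpoint, split by the parity of $u$, gives
$\Theta(q^{9-3n};q^{12})$ and $\Theta(q^{15-3n};q^{12})$, which depend on $n$ modulo 4 up to
monomials. Since $x$ cancels from the Appell denominators, which are all of the form $1+q^n$, each
residue class of $n$ yields Appell series (`hasSum_coeffThree`, `hasSum_coeffFour`). Dividing by
$\Theta(-x^3;q^3)$ gives the formula. Absolute convergence justifies the rearrangements; theta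
series come from the Jacobi triple product `hasSum_thetaTerm`. -/

/-! ### Triangular numbers, convergence of theta series, and the denominators -/

lemma two_mul_binom2 (r : ℤ) : 2 * binom2 r = r * (r - 1) := by
  unfold binom2
  exact Int.mul_ediv_cancel' (Int.even_mul_pred_self r).two_dvd

lemma binom2_eq_of_two_mul {r k : ℤ} (h : 2 * k = r * (r - 1)) : binom2 r = k := by
  have := two_mul_binom2 r
  omega

lemma binom2_add (r s : ℤ) : binom2 (r + s) = binom2 r + binom2 s + r * s :=
  binom2_eq_of_two_mul (by linear_combination two_mul_binom2 r + two_mul_binom2 s)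

/-- The term of the theta series `∑ (-1)^k q^{k(k-1)/2} z^k`. -/
noncomputable def thetaTerm (z q : ℂ) (k : ℤ) : ℂ := (-1) ^ k * q ^ binom2 k * z ^ k

/-- The ratio of consecutive terms is a constant times $\rho^n$ in both directions, so the ratio
test applies for every $w>0$. -/
lemma summable_zpow_binom2_mul_zpow {ρ w : ℝ} (hρ : 0 < ρ) (hρ1 : ρ < 1) (hw : 0 < w) :
    Summable fun k : ℤ => ρ ^ binom2 k * w ^ k := by
  have hpow : Tendsto (fun n : ℕ => ρ ^ n) atTop (𝓝 0) :=
    tendsto_pow_atTop_nhds_zero_of_lt_one hρ.le hρ1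
  refine Summable.of_nat_of_neg ?_ ?_
  · refine summable_of_ratio_test_tendsto_lt_one (l := 0) zero_lt_one
      (Eventually.of_forall fun n => by positivity) ?_
    have : (fun n : ℕ => ‖ρ ^ binom2 ((n + 1 : ℕ) : ℤ) * w ^ ((n + 1 : ℕ) : ℤ)‖ /
        ‖ρ ^ binom2 (n : ℤ) * w ^ (n : ℤ)‖) = fun n => ρ ^ n * w := by
      funext n
      rw [Real.norm_of_nonneg (by positivity), Real.norm_of_nonneg (by positivity),
        div_eq_iff (by positivity), Nat.cast_add, binom2_add,
        binom2_eq_of_two_mul (r := ((1 : ℕ) : ℤ)) (k := 0) (by simp)]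
      simp only [add_zero, Nat.cast_one, mul_one]
      rw [zpow_add₀ hρ.ne', zpow_add₀ hw.ne', zpow_natCast ρ n]
      simp only [zpow_one]
      ring
    rw [this]
    simpa using hpow.mul_const w
  · refine summable_of_ratio_test_tendsto_lt_one (l := 0) zero_lt_one
      (Eventually.of_forall fun n => by positivity) ?_
    have : (fun n : ℕ => ‖ρ ^ binom2 (-((n + 1 : ℕ) : ℤ)) * w ^ (-((n + 1 : ℕ) : ℤ))‖ /
        ‖ρ ^ binom2 (-(n : ℤ)) * w ^ (-(n : ℤ))‖) = fun n => ρ ^ n * (ρ * w⁻¹) := by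
      funext n
      rw [Real.norm_of_nonneg (by positivity), Real.norm_of_nonneg (by positivity),
        div_eq_iff (by positivity), Nat.cast_add, neg_add, binom2_add,
        binom2_eq_of_two_mul (r := -((1 : ℕ) : ℤ)) (k := 1) (by simp)]
      simp only [Nat.cast_one, neg_mul_neg, mul_one]
      rw [zpow_add₀ hρ.ne', zpow_add₀ hρ.ne', zpow_add₀ hw.ne', zpow_natCast ρ n]
      simp only [zpow_one, zpow_neg_one]
      ring
    rw [this]
    simpa using hpow.mul_const (ρ * w⁻¹)

lemma norm_thetaTerm (z q : ℂ) (k : ℤ) : ‖thetaTerm z q k‖ = ‖q‖ ^ binom2 k * ‖z‖ ^ k := by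
  simp [thetaTerm]

lemma summable_norm_thetaTerm {z q : ℂ} (hq0 : q ≠ 0) (hq1 : ‖q‖ < 1) (hz : z ≠ 0) :
    Summable fun k => ‖thetaTerm z q k‖ := by
  simp_rw [norm_thetaTerm]
  exact summable_zpow_binom2_mul_zpow (norm_pos_iff.2 hq0) hq1 (norm_pos_iff.2 hz)

/-- The bound is uniform in $n$, so the denominators $1+q^n$ cost only a constant factor in every
convergence estimate. -/
lemma one_sub_norm_le_norm_one_add_zpow {q : ℂ} (hq0 : q ≠ 0) (hq1 : ‖q‖ < 1) (n : ℤ) :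
    1 - ‖q‖ ≤ ‖1 + q ^ n‖ := by
  have hpos : 0 < ‖q‖ := norm_pos_iff.2 hq0
  rcases lt_trichotomy n 0 with hn | rfl | hn
  · have h1 : 1 ≤ ‖q‖ * ‖q ^ n‖ := by
      rw [norm_zpow, ← zpow_one_add₀ hpos.ne']
      exact one_le_zpow_of_nonpos₀ hpos hq1.le (by omega)
    have h2 : ‖q ^ n‖ - ‖(1 : ℂ)‖ ≤ ‖q ^ n + 1‖ := norm_sub_le_norm_add _ _
    rw [norm_one, add_comm] at h2
    nlinarith [norm_nonneg (q ^ n)]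
  · norm_num
    linarith
  · have h1 : ‖q ^ n‖ ≤ ‖q‖ := by
      rw [norm_zpow]
      simpa using zpow_le_zpow_right_of_le_one₀ hpos hq1.le (show (1 : ℤ) ≤ n by omega)
    have h2 : ‖(1 : ℂ)‖ - ‖q ^ n‖ ≤ ‖1 + q ^ n‖ := norm_sub_le_norm_add _ _
    rw [norm_one] at h2
    linarith

lemma one_add_zpow_ne_zero {q : ℂ} (hq0 : q ≠ 0) (hq1 : ‖q‖ < 1) (n : ℤ) : 1 + q ^ n ≠ 0 := by
  have := one_sub_norm_le_norm_one_add_zpow hq0 hq1 n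
  exact norm_pos_iff.1 (by linarith)

/-! ### Gaussian binomials and the Jacobi triple product -/

/-- The finite `q`-Pochhammer symbol `(x;q)_n`. -/
noncomputable def qPochFin (x q : ℂ) (n : ℕ) : ℂ := ∏ i ∈ Finset.range n, (1 - x * q ^ i)

lemma multipliable_qPoch (x : ℂ) {q : ℂ} (hq1 : ‖q‖ < 1) :
    Multipliable fun i : ℕ => 1 - x * q ^ i := by
  have : Summable fun i : ℕ => ‖-(x * q ^ i)‖ := by
    simp only [norm_neg, norm_mul, norm_pow]
    exact (summable_geometric_of_lt_one (norm_nonneg _) hq1).mul_left _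
  simpa [sub_eq_add_neg] using multipliable_one_add_of_summable this

lemma tendsto_qPochFin (x : ℂ) {q : ℂ} (hq1 : ‖q‖ < 1) :
    Tendsto (qPochFin x q) atTop (𝓝 (qPoch x q)) :=
  (multipliable_qPoch x hq1).tendsto_prod_tprod_nat

lemma one_sub_pow_ne_zero {q : ℂ} (hq1 : ‖q‖ < 1) {n : ℕ} (hn : n ≠ 0) : 1 - q ^ n ≠ 0 := by
  intro h
  have h1 : ‖q‖ ^ n < 1 := pow_lt_one₀ (norm_nonneg _) hq1 hn
  rw [← norm_pow, ← sub_eq_zero.1 h] at h1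
  simp at h1

lemma qPoch_self_ne_zero {q : ℂ} (hq1 : ‖q‖ < 1) : qPoch q q ≠ 0 := by
  have : Summable fun i : ℕ => ‖-(q * q ^ i)‖ := by
    simp only [norm_neg, norm_mul, norm_pow]
    exact (summable_geometric_of_lt_one (norm_nonneg _) hq1).mul_left _
  have h := tprod_one_add_ne_zero_of_summable (f := fun i : ℕ => -(q * q ^ i)) (fun i => by
    rw [← sub_eq_add_neg, ← pow_succ']
    exact one_sub_pow_ne_zero hq1 (by omega)) this
  simpa [qPoch, sub_eq_add_neg] using h

lemma qPochFin_self_ne_zero {q : ℂ} (hq1 : ‖q‖ < 1) (n : ℕ) : qPochFin q q n ≠ 0 := by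
  refine Finset.prod_ne_zero_iff.2 fun i _ => ?_
  rw [← pow_succ']
  exact one_sub_pow_ne_zero hq1 (by omega)

lemma qPochFin_self_succ (q : ℂ) (n : ℕ) :
    qPochFin q q (n + 1) = qPochFin q q n * (1 - q ^ (n + 1)) := by
  rw [qPochFin, Finset.prod_range_succ, ← pow_succ', ← qPochFin]

/-- The Gaussian binomial coefficient, zero for `j > M`. -/
noncomputable def gaussBinom (q : ℂ) (M j : ℕ) : ℂ :=
  if j ≤ M then qPochFin q q M / (qPochFin q q j * qPochFin q q (M - j)) else 0

lemma gaussBinom_zero_right {q : ℂ} (hq1 : ‖q‖ < 1) (M : ℕ) : gaussBinom q M 0 = 1 := by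
  have := qPochFin_self_ne_zero hq1 M
  simpa [gaussBinom, qPochFin] using this

lemma gaussBinom_succ_succ {q : ℂ} (hq1 : ‖q‖ < 1) {M j : ℕ} (hj : j ≤ M) :
    gaussBinom q (M + 1) (j + 1) = gaussBinom q M (j + 1) + q ^ (M - j) * gaussBinom q M j := by
  have hn := qPochFin_self_ne_zero hq1
  obtain ⟨d, rfl⟩ := Nat.exists_eq_add_of_le hj
  -- The case $j=M$ is separate because the first binomial on the right then takes its default value
  -- 0.
  rcases d with _ | d
  · simp only [gaussBinom, add_zero, le_refl, if_true, Nat.sub_self, pow_zero, one_mul]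
    rw [if_neg (by omega), zero_add]
    have h0 := hn 0
    have h1 := hn j
    have h2 := hn (j + 1)
    field_simp
  · simp only [gaussBinom]
    rw [if_pos (by omega), if_pos (by omega), if_pos (by omega),
      show j + (d + 1) + 1 - (j + 1) = d + 1 by omega, show j + (d + 1) - (j + 1) = d by omega,
      show j + (d + 1) - j = d + 1 by omega, qPochFin_self_succ q (j + (d + 1)),
      qPochFin_self_succ q d, qPochFin_self_succ q j]
    have h1 := hn j
    have h2 := hn d
    have h3 := one_sub_pow_ne_zero hq1 (Nat.succ_ne_zero j)
    have h4 := one_sub_pow_ne_zero hq1 (Nat.succ_ne_zero d)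
    simp only [Nat.succ_eq_add_one] at h3 h4
    field_simp
    ring

/-- The `q`-binomial theorem. -/
lemma qPochFin_eq_sum {q : ℂ} (hq1 : ‖q‖ < 1) (w : ℂ) (M : ℕ) :
    qPochFin w q M =
      ∑ j ∈ Finset.range (M + 1), gaussBinom q M j * (-1) ^ j * q ^ (j.choose 2) * w ^ j := by
  induction M with
  | zero => simp [gaussBinom_zero_right hq1, qPochFin]
  | succ M ih =>
    rw [qPochFin, Finset.prod_range_succ, ← qPochFin, Finset.sum_range_succ']
    have h1 : ∀ j ∈ Finset.range (M + 1),
        gaussBinom q (M + 1) (j + 1) * (-1) ^ (j + 1) * q ^ ((j + 1).choose 2) * w ^ (j + 1) =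
        gaussBinom q M (j + 1) * (-1) ^ (j + 1) * q ^ ((j + 1).choose 2) * w ^ (j + 1) +
        gaussBinom q M j * (-1) ^ j * q ^ (j.choose 2) * w ^ j * (-(w * q ^ M)) := by
      intro j hj
      have hj' : j ≤ M := by simpa [Nat.lt_succ_iff] using hj
      rw [gaussBinom_succ_succ hq1 hj', Nat.choose_succ_succ' j 1, Nat.choose_one_right]
      obtain ⟨d, rfl⟩ := Nat.exists_eq_add_of_le hj'
      rw [Nat.add_sub_cancel_left]
      ring
    -- The vanishing binomial at $M+1$ lets the sum for $M$ be extended by one term, so that it can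
    -- be compared after the index shift.
    have h2 := Finset.sum_range_succ
      (fun j => gaussBinom q M j * (-1) ^ j * q ^ (j.choose 2) * w ^ j) (M + 1)
    have h3 : gaussBinom q M (M + 1) = 0 := by simp [gaussBinom]
    rw [← ih, Finset.sum_range_succ', h3, gaussBinom_zero_right hq1] at h2
    rw [Finset.sum_congr rfl h1, Finset.sum_add_distrib, ← Finset.sum_mul, ← ih,
      gaussBinom_zero_right hq1]
    linear_combination -h2

/-- Each factor is reflected by $1-zq^{-k}=-zq^{-k}(1-q^k/z)$ for $1\le k\le N$. -/
lemma qPochFin_mul_zpow_neg {q z : ℂ} (hq0 : q ≠ 0) (hz : z ≠ 0) (N : ℕ) :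
    qPochFin (z * q ^ (-(N : ℤ))) q N =
      (-1) ^ N * z ^ N * q ^ (-binom2 (N + 1)) * qPochFin (q / z) q N := by
  induction N with
  | zero => simp [qPochFin, binom2]
  | succ N ih =>
    have h1 : qPochFin (z * q ^ (-((N + 1 : ℕ) : ℤ))) q (N + 1) =
        qPochFin (z * q ^ (-(N : ℤ))) q N * (1 - z * q ^ (-((N + 1 : ℕ) : ℤ))) := by
      rw [qPochFin, Finset.prod_range_succ', pow_zero, mul_one, qPochFin]
      congr 1
      refine Finset.prod_congr rfl fun i _ => ?_
      rw [Nat.cast_add, neg_add, zpow_add₀ hq0, pow_succ]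
      simp only [Nat.cast_one, zpow_neg_one]
      field_simp
    have h2 : qPochFin (q / z) q (N + 1) = qPochFin (q / z) q N * (1 - q / z * q ^ N) :=
      Finset.prod_range_succ _ _
    have h3 : binom2 (((N + 1 : ℕ) : ℤ) + 1) = binom2 (N + 1) + (N + 1 : ℕ) := by
      rw [Nat.cast_add, Nat.cast_one, binom2_add ((N : ℤ) + 1) 1,
        binom2_eq_of_two_mul (r := 1) (k := 0) (by simp)]
      ring
    have h4 : z * q ^ (-((N + 1 : ℕ) : ℤ)) * (q / z * q ^ N) = 1 := by
      rw [zpow_neg, zpow_natCast, pow_succ]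
      field_simp
    rw [h1, ih, h2, h3, neg_add, zpow_add₀ hq0]
    linear_combination
      -(-1) ^ N * z ^ N * q ^ (-binom2 (N + 1)) * qPochFin (q / z) q N * h4

lemma binom2_natCast (j : ℕ) : binom2 j = (j.choose 2 : ℕ) := by
  refine binom2_eq_of_two_mul ?_
  induction j with
  | zero => simp
  | succ j ih =>
    rw [Nat.choose_succ_succ' j 1, Nat.choose_one_right]
    push_cast at ih ⊢
    linear_combination ih

/-- The finite form of the Jacobi triple product identity. -/
lemma qPochFin_mul_qPochFin {q z : ℂ} (hq0 : q ≠ 0) (hq1 : ‖q‖ < 1) (hz : z ≠ 0) (N : ℕ) :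
    qPochFin z q N * qPochFin (q / z) q N =
      ∑ j ∈ Finset.range (2 * N + 1), gaussBinom q (2 * N) j * thetaTerm z q (j - N) := by
  -- The $2N$ consecutive factors starting at $zq^{-N}$ contain both products: the first half is the
  -- reflected $(q/z;q)_N$. The $q$-binomial theorem then expands the whole.
  have h1 : qPochFin (z * q ^ (-(N : ℤ))) q (2 * N) =
      qPochFin (z * q ^ (-(N : ℤ))) q N * qPochFin z q N := by
    rw [qPochFin, two_mul, Finset.prod_range_add, qPochFin, qPochFin]
    congr 1
    refine Finset.prod_congr rfl fun i _ => ?_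
    rw [pow_add, zpow_neg, zpow_natCast]
    field_simp
  have hK : ((-1) ^ N * z ^ N * q ^ (-binom2 (N + 1)) : ℂ) ≠ 0 := by
    have := zpow_ne_zero (-binom2 (N + 1)) hq0
    have := pow_ne_zero N hz
    simp_all
  apply mul_left_cancel₀ hK
  rw [mul_comm (qPochFin z q N), ← mul_assoc, ← qPochFin_mul_zpow_neg hq0 hz, ← h1,
    qPochFin_eq_sum hq1, Finset.mul_sum]
  refine Finset.sum_congr rfl fun j _ => ?_
  have e1 : binom2 ((j : ℤ) - N) = binom2 j - j * N + binom2 (N + 1) :=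
    binom2_eq_of_two_mul
      (by linear_combination two_mul_binom2 (j : ℤ) + two_mul_binom2 ((N : ℤ) + 1))
  have e2 : (-1 : ℂ) ^ N * (-1) ^ N = 1 := by rw [← mul_pow]; simp
  have e3 : q ^ binom2 ((j : ℤ) - N) =
      q ^ (j.choose 2) * (q ^ (-(N : ℤ))) ^ j * (q ^ (-binom2 (N + 1)))⁻¹ := by
    rw [← zpow_natCast q (j.choose 2), ← binom2_natCast, ← zpow_natCast (q ^ (-(N : ℤ))),
      ← zpow_mul, ← zpow_neg, ← zpow_add₀ hq0, ← zpow_add₀ hq0, e1]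
    congr 1
    ring
  rw [thetaTerm, e3, zpow_sub₀ hz, zpow_sub₀ (by norm_num), mul_pow]
  simp only [zpow_natCast]
  have := zpow_ne_zero (-binom2 (N + 1)) hq0
  have := pow_ne_zero N hz
  field_simp

/-- The $(q;q)_n$ converge to a nonzero limit, so they and their inverses are bounded. This supplies
the domination for the limit in the triple product. -/
lemma exists_norm_gaussBinom_le {q : ℂ} (hq1 : ‖q‖ < 1) :
    ∃ C : ℝ, 0 ≤ C ∧ ∀ M j, ‖gaussBinom q M j‖ ≤ C := by
  have h1 := tendsto_qPochFin q hq1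
  have h2 := h1.inv₀ (qPoch_self_ne_zero hq1)
  obtain ⟨A, hA⟩ := h1.norm.bddAbove_range
  obtain ⟨B, hB⟩ := h2.norm.bddAbove_range
  have hA' : ∀ n, ‖qPochFin q q n‖ ≤ A := fun n => hA ⟨n, rfl⟩
  have hB' : ∀ n, ‖(qPochFin q q n)⁻¹‖ ≤ B := fun n => hB ⟨n, rfl⟩
  have hA0 : 0 ≤ A := (norm_nonneg _).trans (hA' 0)
  have hB0 : 0 ≤ B := (norm_nonneg _).trans (hB' 0)
  refine ⟨A * (B * B), by positivity, fun M j => ?_⟩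
  rw [gaussBinom]
  split_ifs
  · rw [div_eq_mul_inv, mul_inv, norm_mul, norm_mul]
    gcongr
    exacts [hA' _, hB' _, hB' _]
  · simp only [norm_zero]
    positivity

/-- The Jacobi triple product identity. -/
theorem hasSum_thetaTerm {q z : ℂ} (hq0 : q ≠ 0) (hq1 : ‖q‖ < 1) (hz : z ≠ 0) :
    HasSum (thetaTerm z q) (Theta z q) := by
  obtain ⟨C, hC0, hC⟩ := exists_norm_gaussBinom_le hq1
  -- The finite identity becomes a sum over all of $\mathbb Z$ with index $k=j-N$. The guard is
  -- needed because `toNat` sends negative integers to 0.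
  let c : ℕ → ℤ → ℂ := fun N k => if 0 ≤ k + N then gaussBinom q (2 * N) (k + N).toNat else 0
  have hsum := summable_norm_thetaTerm hq0 hq1 hz
  have hcN : ∀ N, ∑' k, c N k * thetaTerm z q k =
      qPochFin z q N * qPochFin (q / z) q N := by
    intro N
    have hinj : Function.Injective fun j : ℕ => (j : ℤ) - N := fun a b h => by
      simpa using h
    rw [← hinj.tsum_eq, qPochFin_mul_qPochFin hq0 hq1 hz, tsum_eq_sum (s := Finset.range (2 * N + 1))]
    · refine Finset.sum_congr rfl fun j _ => ?_
      simp [c]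
    · intro j hj
      have : ¬ j ≤ 2 * N := by simpa [Nat.lt_succ_iff] using hj
      simp only [c, gaussBinom, sub_add_cancel, Nat.cast_nonneg, Int.toNat_natCast, if_true]
      rw [if_neg this, zero_mul]
    · intro k hk
      have : 0 ≤ k + N := by
        by_contra h
        simp [c, h] at hk
      exact ⟨(k + N).toNat, by simp [this]⟩
  have hlim : ∀ k, Tendsto (fun N => c N k * thetaTerm z q k) atTop
      (𝓝 ((qPoch q q)⁻¹ * thetaTerm z q k)) := by
    intro k
    refine Tendsto.mul_const _ ?_
    have t0 := tendsto_qPochFin q hq1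
    have t1 : Tendsto (fun N : ℕ => 2 * N) atTop atTop :=
      tendsto_id.const_mul_atTop' (by norm_num)
    have t2 : Tendsto (fun N : ℕ => (k + N).toNat) atTop atTop :=
      tendsto_atTop.2 fun b => by
        filter_upwards [eventually_ge_atTop (b + k.natAbs)] with N hN
        omega
    have t3 : Tendsto (fun N : ℕ => 2 * N - (k + N).toNat) atTop atTop :=
      tendsto_atTop.2 fun b => by
        filter_upwards [eventually_ge_atTop (b + k.natAbs)] with N hN
        omega
    have h0 := qPoch_self_ne_zero hq1
    have t4 := (t0.comp t1).div ((t0.comp t2).mul (t0.comp t3)) (mul_ne_zero h0 h0)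
    rw [div_mul_cancel_left₀ h0] at t4
    refine t4.congr' ?_
    filter_upwards [eventually_ge_atTop k.natAbs] with N hN
    have e1 : 0 ≤ k + N := by omega
    have e2 : (k + N).toNat ≤ 2 * N := by omega
    simp only [c, gaussBinom]
    rw [if_pos e1, if_pos e2]
    rfl
  -- Each coefficient tends to $1/(q)_\infty$ and is bounded by $C$, so the limit passes inside the
  -- sum.
  have key := tendsto_tsum_of_dominated_convergence (hsum.mul_left C) hlim
    (Eventually.of_forall fun N k => by
      rw [norm_mul]
      gcongr
      simp only [c]
      split_ifs
      · exact hC _ _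
      · simpa using hC0)
  simp_rw [hcN] at key
  have h1 := tendsto_nhds_unique key
    ((tendsto_qPochFin z hq1).mul (tendsto_qPochFin (q / z) hq1))
  rw [tsum_mul_left, inv_mul_eq_iff_eq_mul₀ (qPoch_self_ne_zero hq1), mul_comm] at h1
  rw [Theta, ← h1]
  exact hsum.of_norm.hasSum

/-! ### Quasi-periodicity and special values of theta -/

lemma pow_zpow_eq (x : ℂ) (k : ℕ) (t : ℤ) : (x ^ k) ^ t = x ^ ((k : ℤ) * t) := by
  rw [zpow_mul, zpow_natCast]

lemma neg_zpow_eq (x : ℂ) (t : ℤ) : (-x) ^ t = (-1) ^ t * x ^ t := by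
  rw [neg_eq_neg_one_mul, mul_zpow]

lemma neg_one_zpow_congr {a b : ℤ} (c : ℤ) (h : a = b + 2 * c) : (-1 : ℂ) ^ a = (-1) ^ b := by
  rw [h, zpow_add₀ (by norm_num), zpow_mul]
  norm_num

/-- Quasi-periodicity of the theta function. -/
lemma Theta_zpow_add {q : ℂ} (hq0 : q ≠ 0) (hq1 : ‖q‖ < 1) {N : ℕ} (hN : N ≠ 0) (m j : ℤ) :
    Theta (q ^ (N * m + j)) (q ^ N) =
      (-1) ^ m * q ^ (-(N * binom2 m) - j * m) * Theta (q ^ j) (q ^ N) := by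
  have hqN0 : q ^ N ≠ 0 := pow_ne_zero _ hq0
  have hqN1 : ‖q ^ N‖ < 1 := by
    rw [norm_pow]
    exact pow_lt_one₀ (norm_nonneg _) hq1 hN
  have h1 := hasSum_thetaTerm hqN0 hqN1 (zpow_ne_zero (N * m + j) hq0)
  have h2 := ((Equiv.addRight m).hasSum_iff.2
    (hasSum_thetaTerm hqN0 hqN1 (zpow_ne_zero j hq0))).mul_left
      ((-1) ^ m * q ^ (-(N * binom2 m) - j * m))
  refine h1.unique (h2.congr_fun ?_)
  intro k
  simp only [thetaTerm, Function.comp, Equiv.coe_addRight]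
  rw [pow_zpow_eq, pow_zpow_eq, ← zpow_mul, ← zpow_mul]
  have e1 : (-1 : ℂ) ^ k = (-1) ^ m * (-1) ^ (k + m) := by
    rw [← zpow_add₀ (by norm_num)]
    exact neg_one_zpow_congr (-m) (by ring)
  have e2 : q ^ (N * binom2 k) * q ^ ((N * m + j) * k) =
      q ^ (-(N * binom2 m) - j * m) * q ^ (N * binom2 (k + m)) * q ^ (j * (k + m)) := by
    rw [← zpow_add₀ hq0, ← zpow_add₀ hq0, ← zpow_add₀ hq0, binom2_add]
    congr 1
    ring
  rw [mul_assoc, e2, e1]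
  ring

/-- This zero removes the classes $3\mid n$ in base $q^3$, and one of the two base $q^{12}$ thetas
for each odd $n$. -/
lemma Theta_one (q : ℂ) : Theta 1 q = 0 := by
  have : qPoch 1 q = 0 := tprod_of_exists_eq_zero ⟨0, by simp⟩
  simp [Theta, this]

lemma Theta_div {q z : ℂ} (hq0 : q ≠ 0) : Theta (q / z) q = Theta z q := by
  rw [Theta, Theta, div_div_cancel₀ hq0, mul_comm (qPoch (q / z) q)]

lemma Theta_zpow_sub {q : ℂ} (hq0 : q ≠ 0) (N : ℕ) (j : ℤ) :
    Theta (q ^ ((N : ℤ) - j)) (q ^ N) = Theta (q ^ j) (q ^ N) := by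
  rw [zpow_sub₀ hq0, zpow_natCast, Theta_div (pow_ne_zero _ hq0)]

/-- The three products run over the exponents congruent to 1, 2 and 0 modulo 3, which together
exhaust those of $(q)_\infty$. -/
lemma Theta_self_pow_three {q : ℂ} (hq0 : q ≠ 0) (hq1 : ‖q‖ < 1) :
    Theta q (q ^ 3) = qPoch q q := by
  have hq3 : ‖q ^ 3‖ < 1 := by
    rw [norm_pow]
    exact pow_lt_one₀ (norm_nonneg _) hq1 (by norm_num)
  have h1 := ((tendsto_qPochFin q hq3).mul (tendsto_qPochFin (q ^ 3 / q) hq3)).mul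
    (tendsto_qPochFin (q ^ 3) hq3)
  have h2 : Tendsto (fun n : ℕ => qPochFin q q (3 * n)) atTop (𝓝 (qPoch q q)) :=
    (tendsto_qPochFin q hq1).comp (tendsto_id.const_mul_atTop' (by norm_num))
  refine tendsto_nhds_unique h1 (h2.congr fun n => ?_)
  have e : q ^ 3 / q = q ^ 2 := by field_simp
  rw [e]
  induction n with
  | zero => simp [qPochFin]
  | succ n ih =>
    simp only [qPochFin, mul_add, mul_one] at ih ⊢
    simp only [Finset.prod_range_succ, ih, show 3 * n + 3 = 3 * n + 1 + 1 + 1 by ring]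
    ring

lemma Theta_zpow_two_pow_three {q : ℂ} (hq0 : q ≠ 0) (hq1 : ‖q‖ < 1) :
    Theta (q ^ (2 : ℤ)) (q ^ 3) = qPoch q q := by
  rw [show (2 : ℤ) = ((3 : ℕ) : ℤ) - 1 by norm_num, Theta_zpow_sub hq0, zpow_one,
    Theta_self_pow_three hq0 hq1]

lemma norm_pow_lt_one {q : ℂ} (hq1 : ‖q‖ < 1) {N : ℕ} (hN : N ≠ 0) : ‖q ^ N‖ < 1 := by
  rw [norm_pow]
  exact pow_lt_one₀ (norm_nonneg _) hq1 hN

/-! ### The double sum times theta: convergence and separation of variables -/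

lemma sg₂_eq (r s : ℤ) :
    sg₂ r s = (if 0 ≤ r ∧ 0 ≤ s then 1 else 0) - (if r < 0 ∧ s < 0 then 1 else 0) := by
  unfold sg₂ sg
  split_ifs <;> omega

/-- A nonzero sign factor forces $rs\ge 0$, so $|q^{2rs}|\le 1$ and the indefinite cross term can be
dropped. -/
lemma norm_heckeTerm_le {q : ℂ} (hq0 : q ≠ 0) (hq1 : ‖q‖ < 1) (X Y : ℂ) (p : ℤ × ℤ) :
    ‖heckeTerm 1 2 3 X Y q p‖ ≤ ‖thetaTerm X q p.1‖ * ‖thetaTerm Y (q ^ 3) p.2‖ := by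
  obtain ⟨r, s⟩ := p
  have hpos : 0 < ‖q‖ := norm_pos_iff.2 hq0
  by_cases h : sg₂ r s = 0
  · simp only [heckeTerm, h]
    simp only [Int.cast_zero, zero_mul, norm_zero]
    positivity
  have hrs : 0 ≤ r * s ∧ ‖(sg₂ r s : ℂ)‖ = 1 := by
    rw [sg₂_eq] at h ⊢
    split_ifs at h ⊢ with h1 h2 h2
    · omega
    · exact ⟨mul_nonneg h1.1 h1.2, by simp⟩
    · exact ⟨(mul_pos_of_neg_of_neg h2.1 h2.2).le, by simp⟩
    · simp at h
  simp only [heckeTerm, norm_thetaTerm, norm_mul, hrs.2, norm_zpow, norm_neg, norm_one, one_zpow,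
    norm_pow, one_mul]
  rw [← zpow_natCast ‖q‖ 3, ← zpow_mul]
  have : ‖q‖ ^ (binom2 r + 2 * r * s + 3 * binom2 s) ≤
      ‖q‖ ^ binom2 r * ‖q‖ ^ (((3 : ℕ) : ℤ) * binom2 s) := by
    rw [← zpow_add₀ hpos.ne']
    exact zpow_le_zpow_right_of_le_one₀ hpos hq1.le (by push_cast; nlinarith [hrs.1])
  calc _ ≤ ‖X‖ ^ r * ‖Y‖ ^ s * (‖q‖ ^ binom2 r * ‖q‖ ^ (((3 : ℕ) : ℤ) * binom2 s)) := by gcongr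
    _ = _ := by ring

lemma summable_norm_heckeTerm {q X Y : ℂ} (hq0 : q ≠ 0) (hq1 : ‖q‖ < 1) (hX : X ≠ 0)
    (hY : Y ≠ 0) : Summable fun p => ‖heckeTerm 1 2 3 X Y q p‖ :=
  Summable.of_nonneg_of_le (fun _ => norm_nonneg _) (norm_heckeTerm_le hq0 hq1 X Y)
    ((summable_norm_thetaTerm hq0 hq1 hX).mul_of_nonneg
      (summable_norm_thetaTerm (pow_ne_zero 3 hq0) (norm_pow_lt_one hq1 (by norm_num)) hY)
      (fun _ => norm_nonneg _) fun _ => norm_nonneg _)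

lemma sum_Ico_zpow {w : ℂ} (hw0 : w ≠ 0) (hw1 : w ≠ 1) {a b : ℤ} (hab : a ≤ b) :
    ∑ t ∈ Finset.Ico a b, w ^ t = (w ^ a - w ^ b) / (1 - w) := by
  have h1 : 1 - w ≠ 0 := sub_ne_zero.2 hw1.symm
  induction b, hab using Int.leInduction with
  | base => simp
  | succ b hb ih =>
    have : Finset.Ico a (b + 1) = insert b (Finset.Ico a b) := by
      ext t
      simp only [Finset.mem_Ico, Finset.mem_insert]
      omega
    rw [this, Finset.sum_insert (by simp), ih, zpow_add₀ hw0, zpow_one]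
    field_simp
    ring

/-- A signed geometric sum between two arbitrary integers. -/
lemma hasSum_signed_zpow {w : ℂ} (hw0 : w ≠ 0) (hw1 : w ≠ 1) (a b : ℤ) :
    HasSum (fun t : ℤ => (((if a ≤ t ∧ t < b then 1 else 0) -
      (if t < a ∧ b ≤ t then 1 else 0) : ℤ) : ℂ) * w ^ t) ((w ^ a - w ^ b) / (1 - w)) := by
  rcases le_total a b with hab | hab
  · rw [← sum_Ico_zpow hw0 hw1 hab]
    have h : ∀ t ∈ Finset.Ico a b, w ^ t = (((if a ≤ t ∧ t < b then 1 else 0) -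
      (if t < a ∧ b ≤ t then 1 else 0) : ℤ) : ℂ) * w ^ t := by
      intro t ht
      rw [Finset.mem_Ico] at ht
      rw [if_pos ht, if_neg (by omega)]
      simp
    rw [Finset.sum_congr rfl h]
    refine hasSum_sum_of_ne_finset_zero fun t ht => ?_
    rw [Finset.mem_Ico] at ht
    rw [if_neg ht, if_neg (by omega)]
    simp
  · rw [show (w ^ a - w ^ b) / (1 - w) = -((w ^ b - w ^ a) / (1 - w)) by ring,
      ← sum_Ico_zpow hw0 hw1 hab, ← Finset.sum_neg_distrib]
    have h : ∀ t ∈ Finset.Ico b a, -w ^ t = (((if a ≤ t ∧ t < b then 1 else 0) -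
      (if t < a ∧ b ≤ t then 1 else 0) : ℤ) : ℂ) * w ^ t := by
      intro t ht
      rw [Finset.mem_Ico] at ht
      rw [if_neg (by omega), if_pos ⟨ht.2, ht.1⟩]
      simp
    rw [Finset.sum_congr rfl h]
    refine hasSum_sum_of_ne_finset_zero fun t ht => ?_
    rw [Finset.mem_Ico] at ht
    rw [if_neg (by omega), if_neg (by omega)]
    simp

/-- In the exponent of $q$ the terms in $t^2$, $ut$ and $t$ all cancel, and only $nt$ survives;
hence the dependence on $t$ is geometric apart from the sign factor. -/
lemma heckeTerm_mul_thetaTerm {q x : ℂ} (hq0 : q ≠ 0) (hx : x ≠ 0) (n u t : ℤ) :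
    heckeTerm 1 2 3 (x⁻¹ * q ^ 2) (q ^ 3) q (3 * t - n, u - 2 * t) *
        thetaTerm (-x ^ 3) (q ^ 3) t =
      x ^ n * ((-1) ^ n * q ^ (binom2 n - n)) * (thetaTerm (q ^ (3 - 2 * n)) (q ^ 3) u *
        ((sg₂ (3 * t - n) (u - 2 * t) : ℂ) * (-q ^ n) ^ t)) := by
  simp only [heckeTerm, thetaTerm]
  rw [neg_zpow_eq (x ^ 3), neg_zpow_eq (q ^ n), mul_zpow, inv_zpow', pow_zpow_eq, pow_zpow_eq,
    pow_zpow_eq, pow_zpow_eq, pow_zpow_eq, ← zpow_mul, ← zpow_mul]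
  have e1 : (-1 : ℂ) ^ (3 * t - n + (u - 2 * t)) * (-1) ^ t * (-1) ^ t =
      (-1) ^ n * (-1) ^ u * (-1) ^ t := by
    simp only [← zpow_add₀ (show (-1 : ℂ) ≠ 0 by norm_num)]
    exact neg_one_zpow_congr (t - n) (by ring)
  have e2 : x ^ (-(3 * t - n)) * x ^ (((3 : ℕ) : ℤ) * t) = x ^ n := by
    rw [← zpow_add₀ hx]
    congr 1
    push_cast
    ring
  have e3 : q ^ (((2 : ℕ) : ℤ) * (3 * t - n)) * q ^ (((3 : ℕ) : ℤ) * (u - 2 * t)) *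
      q ^ (1 * binom2 (3 * t - n) + 2 * (3 * t - n) * (u - 2 * t) + 3 * binom2 (u - 2 * t)) *
      q ^ (((3 : ℕ) : ℤ) * binom2 t) =
      q ^ (binom2 n - n) * q ^ (((3 : ℕ) : ℤ) * binom2 u) * q ^ ((3 - 2 * n) * u) *
        q ^ (n * t) := by
    simp only [← zpow_add₀ hq0]
    congr 1
    apply mul_left_cancel₀ (two_ne_zero (α := ℤ))
    push_cast
    linear_combination two_mul_binom2 (3 * t - n) + 3 * two_mul_binom2 (u - 2 * t) +
      3 * two_mul_binom2 t - two_mul_binom2 n - 3 * two_mul_binom2 u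
  calc _ = (sg₂ (3 * t - n) (u - 2 * t) : ℂ) *
        ((-1 : ℂ) ^ (3 * t - n + (u - 2 * t)) * (-1) ^ t * (-1) ^ t) *
        (x ^ (-(3 * t - n)) * x ^ (((3 : ℕ) : ℤ) * t)) *
        (q ^ (((2 : ℕ) : ℤ) * (3 * t - n)) * q ^ (((3 : ℕ) : ℤ) * (u - 2 * t)) *
      q ^ (1 * binom2 (3 * t - n) + 2 * (3 * t - n) * (u - 2 * t) + 3 * binom2 (u - 2 * t)) *
      q ^ (((3 : ℕ) : ℤ) * binom2 t)) := by ring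
    _ = _ := by
      rw [e1, e2, e3]
      ring

/-! ### Splitting series by residue classes -/

/-- A series over `ℤ` is summed along a shifted system of residues mod `N`. -/
lemma hasSum_of_residues {f : ℤ → ℂ} (N : ℕ) [NeZero N] (c : ℤ) {S : Fin N → ℂ}
    (h : ∀ j : Fin N, HasSum (fun m : ℤ => f (N * m + j + c)) (S j)) :
    HasSum f (∑ j, S j) := by
  have h1 : HasSum (fun p : Fin N × ℤ => f (N * p.2 + p.1 + c)) (∑ j, S j) := by
    classical
    -- Each residue class is extended by zero to all of `Fin N × ℤ`; the finitely many extensions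
    -- add up to the full family.
    have h2 : ∀ j : Fin N, HasSum
        (fun p : Fin N × ℤ => if p.1 = j then f (N * p.2 + p.1 + c) else 0) (S j) := by
      intro j
      have hinj : Function.Injective (fun m : ℤ => (j, m)) := fun a b h => by simpa using h
      refine (hinj.hasSum_iff ?_).1 ?_
      · rintro ⟨i, m⟩ him
        refine if_neg fun h => him ⟨m, ?_⟩
        simp_all
      · convert h j using 2 with m
        simp
    have h3 := hasSum_sum fun (j : Fin N) (_ : j ∈ Finset.univ) => h2 j
    convert h3 using 2 with p
    simp
  have h4 := ((Equiv.prodComm _ _).trans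
    ((Int.divModEquiv N).symm.trans (Equiv.addRight c))).hasSum_iff (f := f) (a := ∑ j, S j)
  refine h4.1 ?_
  convert h1 using 2 with p
  simp [mul_comm]

lemma hasSum_of_residues_two {f : ℤ → ℂ} {S₀ S₁ : ℂ} (h₀ : HasSum (fun m => f (2 * m)) S₀)
    (h₁ : HasSum (fun m => f (2 * m + 1)) S₁) : HasSum f (S₀ + S₁) := by
  have h := hasSum_of_residues (f := f) 2 0 (S := ![S₀, S₁]) fun j => by
    fin_cases j
    · simpa using h₀
    · simpa using h₁
  simpa using h

lemma hasSum_of_residues_three {f : ℤ → ℂ} {S₁ S₂ S₃ : ℂ}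
    (h₁ : HasSum (fun m => f (3 * m - 2)) S₁) (h₂ : HasSum (fun m => f (3 * m - 1)) S₂)
    (h₃ : HasSum (fun m => f (3 * m)) S₃) : HasSum f (S₁ + S₂ + S₃) := by
  have h := hasSum_of_residues (f := f) 3 (-2) (S := ![S₁, S₂, S₃]) fun j => by
    fin_cases j
    · simpa [← sub_eq_add_neg] using h₁
    · refine h₂.congr_fun fun m => congrArg f ?_
      simp
      ring
    · simpa using h₃
  simpa [Fin.sum_univ_succ, add_assoc] using h

lemma hasSum_of_residues_four {f : ℤ → ℂ} {S₁ S₂ S₃ S₄ : ℂ}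
    (h₁ : HasSum (fun m => f (4 * m - 3)) S₁) (h₂ : HasSum (fun m => f (4 * m - 2)) S₂)
    (h₃ : HasSum (fun m => f (4 * m - 1)) S₃) (h₄ : HasSum (fun m => f (4 * m)) S₄) :
    HasSum f (S₁ + S₂ + S₃ + S₄) := by
  have h := hasSum_of_residues (f := f) 4 (-3) (S := ![S₁, S₂, S₃, S₄]) fun j => by
    fin_cases j
    · simpa [← sub_eq_add_neg] using h₁
    · refine h₂.congr_fun fun m => congrArg f ?_
      simp
      ring
    · refine h₃.congr_fun fun m => congrArg f ?_
      simp
      ring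
    · simpa using h₄
  simpa [Fin.sum_univ_succ, add_assoc] using h

/-- This is the upper endpoint of the geometric sum. Both $u=2v$ and $u=2v+1$ have $\lfloor
u/2\rfloor=v$, and $3\binom u2$ becomes $12\binom v2$ plus a linear term, so each parity class is a
theta series in base $q^{12}$. -/
lemma hasSum_thetaTerm_mul_zpow_half {q : ℂ} (hq0 : q ≠ 0) (hq1 : ‖q‖ < 1) (n : ℤ) :
    HasSum (fun u : ℤ => thetaTerm (q ^ (3 - 2 * n)) (q ^ 3) u * (-q ^ n) ^ (u / 2 + 1))
      (-(q ^ n * Theta (q ^ (9 - 3 * n)) (q ^ 12)) +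
        q ^ (3 - n) * Theta (q ^ (15 - 3 * n)) (q ^ 12)) := by
  have hT : ∀ k : ℤ, HasSum (thetaTerm (q ^ k) (q ^ 12)) (Theta (q ^ k) (q ^ 12)) := fun k =>
    hasSum_thetaTerm (pow_ne_zero _ hq0) (norm_pow_lt_one hq1 (by norm_num)) (zpow_ne_zero k hq0)
  apply hasSum_of_residues_two
  · rw [← neg_mul]
    refine ((hT _).mul_left _).congr_fun fun v => ?_
    have e0 : (2 * v) / 2 + 1 = v + 1 := by omega
    have hb : binom2 (2 * v) = 4 * binom2 v + v :=
      binom2_eq_of_two_mul (by linear_combination 4 * two_mul_binom2 v)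
    have e1 : (-1 : ℂ) ^ (2 * v) = 1 := by simp [zpow_mul]
    have e2 : (-1 : ℂ) ^ (v + 1) = -(-1) ^ v := by
      rw [zpow_add₀ (by norm_num), zpow_one, mul_neg_one]
    have e3 : q ^ (((3 : ℕ) : ℤ) * (4 * binom2 v + v)) * q ^ ((3 - 2 * n) * (2 * v)) *
        q ^ (n * (v + 1)) = q ^ n * q ^ (((12 : ℕ) : ℤ) * binom2 v) * q ^ ((9 - 3 * n) * v) := by
      simp only [← zpow_add₀ hq0]
      congr 1
      push_cast
      ring
    rw [e0, thetaTerm, thetaTerm, neg_zpow_eq (q ^ n), pow_zpow_eq, pow_zpow_eq, ← zpow_mul,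
      ← zpow_mul, ← zpow_mul, hb, e1, e2]
    linear_combination -(-1) ^ v * e3
  · refine ((hT _).mul_left _).congr_fun fun v => ?_
    have e0 : (2 * v + 1) / 2 + 1 = v + 1 := by omega
    have hb : binom2 (2 * v + 1) = 4 * binom2 v + 3 * v :=
      binom2_eq_of_two_mul (by linear_combination 4 * two_mul_binom2 v)
    have e1 : (-1 : ℂ) ^ (2 * v + 1) = -1 := by
      rw [zpow_add₀ (by norm_num), zpow_mul]
      simp
    have e2 : (-1 : ℂ) ^ (v + 1) = -(-1) ^ v := by
      rw [zpow_add₀ (by norm_num), zpow_one, mul_neg_one]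
    have e3 : q ^ (((3 : ℕ) : ℤ) * (4 * binom2 v + 3 * v)) * q ^ ((3 - 2 * n) * (2 * v + 1)) *
        q ^ (n * (v + 1)) =
        q ^ (3 - n) * q ^ (((12 : ℕ) : ℤ) * binom2 v) * q ^ ((15 - 3 * n) * v) := by
      simp only [← zpow_add₀ hq0]
      congr 1
      push_cast
      ring
    rw [e0, thetaTerm, thetaTerm, neg_zpow_eq (q ^ n), pow_zpow_eq, pow_zpow_eq, ← zpow_mul,
      ← zpow_mul, ← zpow_mul, hb, e1, e2]
    linear_combination (-1) ^ v * e3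

/-! ### Laurent coefficients of the product -/

/-- The part of the coefficient of `x ^ n` that is supported on `n` prime to `3`. -/
noncomputable def coeffThree (q : ℂ) (n : ℤ) : ℂ :=
  (-1) ^ (n + -(-n / 3)) * q ^ (binom2 n - n + n * -(-n / 3)) *
    Theta (q ^ (3 - 2 * n)) (q ^ 3) / (1 + q ^ n)

/-- The part of the coefficient of `x ^ n` that depends on `n` modulo `4`. -/
noncomputable def coeffFour (q : ℂ) (n : ℤ) : ℂ :=
  ((-1) ^ n * q ^ binom2 n * Theta (q ^ (9 - 3 * n)) (q ^ 12) -
    (-1) ^ n * q ^ (binom2 n - 2 * n + 3) * Theta (q ^ (15 - 3 * n)) (q ^ 12)) / (1 + q ^ n)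

/-- The change of variables `(n, u, t) ↦ ((3t - n, u - 2t), t)`. -/
def shearEquiv : ℤ × ℤ × ℤ ≃ (ℤ × ℤ) × ℤ where
  toFun p := ((3 * p.2.2 - p.1, p.2.1 - 2 * p.2.2), p.2.2)
  invFun p := (3 * p.2 - p.1.1, p.1.2 + 2 * p.2, p.2)
  left_inv p := by ext <;> simp
  right_inv p := by ext <;> simp

lemma hasSum_hecke_mul_Theta {q x : ℂ} (hq0 : q ≠ 0) (hq1 : ‖q‖ < 1) (hx : x ≠ 0) :
    HasSum (fun n : ℤ => x ^ n * (coeffThree q n + coeffFour q n))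
      (hecke 1 2 3 (x⁻¹ * q ^ 2) (q ^ 3) q * Theta (-x ^ 3) (q ^ 3)) := by
  have hq3 : q ^ 3 ≠ 0 := pow_ne_zero 3 hq0
  have hq3' : ‖q ^ 3‖ < 1 := norm_pow_lt_one hq1 (by norm_num)
  have hx3 : -x ^ 3 ≠ 0 := neg_ne_zero.2 (pow_ne_zero 3 hx)
  have hH := summable_norm_heckeTerm hq0 hq1
    (mul_ne_zero (inv_ne_zero hx) (pow_ne_zero 2 hq0)) hq3
  have hG := shearEquiv.hasSum_iff.2 (hH.of_norm.hasSum.mul (hasSum_thetaTerm hq3 hq3' hx3)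
    (summable_mul_of_summable_norm hH (summable_norm_thetaTerm hq3 hq3' hx3)))
  refine hG.prod_fiberwise fun n => ?_
  have hw1 : 1 + q ^ n ≠ 0 := one_add_zpow_ne_zero hq0 hq1 n
  have hw0 : -q ^ n ≠ 0 := neg_ne_zero.2 (zpow_ne_zero n hq0)
  have hne : -q ^ n ≠ 1 := fun h => hw1 (by rw [← h]; ring)
  -- Summability alone provides the fibre sum over $(u,t)$; its value is identified by summing over
  -- $t$ first and then over $u$.
  obtain ⟨S, hfib⟩ := hG.summable.prod_factor n
  have hu : HasSum (fun u : ℤ => x ^ n * ((-1) ^ n * q ^ (binom2 n - n)) *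
      (thetaTerm (q ^ (3 - 2 * n)) (q ^ 3) u *
        (((-q ^ n) ^ (-(-n / 3)) - (-q ^ n) ^ (u / 2 + 1)) / (1 - -q ^ n))))
      S := by
    refine hfib.prod_fiberwise fun u => ?_
    refine (((hasSum_signed_zpow hw0 hne (-(-n / 3)) (u / 2 + 1)).mul_left _).mul_left
      _).congr_fun fun t => ?_
    simp only [Function.comp, shearEquiv, Equiv.coe_fn_mk]
    rw [heckeTerm_mul_thetaTerm hq0 hx, sg₂_eq]
    -- Integer division is floor division, so `-(-n / 3)` is $\lceil n/3\rceil$. Both signs of the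
    -- sign factor match the signed interval, including when its endpoints are reversed.
    have c1 : (0 ≤ 3 * t - n ∧ 0 ≤ u - 2 * t) ↔ (-(-n / 3) ≤ t ∧ t < u / 2 + 1) := by omega
    have c2 : (3 * t - n < 0 ∧ u - 2 * t < 0) ↔ (t < -(-n / 3) ∧ u / 2 + 1 ≤ t) := by omega
    simp only [c1, c2]
  have hv := ((((hasSum_thetaTerm hq3 hq3' (zpow_ne_zero (3 - 2 * n) hq0)).mul_left
    ((-q ^ n) ^ (-(-n / 3)))).sub (hasSum_thetaTerm_mul_zpow_half hq0 hq1 n)).div_const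
      (1 - -q ^ n)).mul_left (x ^ n * ((-1) ^ n * q ^ (binom2 n - n)))
  have hval := hu.unique (hv.congr_fun fun u => by ring)
  suffices h : x ^ n * (coeffThree q n + coeffFour q n) = S from h ▸ hfib
  rw [hval, coeffThree, coeffFour, neg_zpow_eq (q ^ n), ← zpow_mul,
    zpow_add₀ (show (-1 : ℂ) ≠ 0 by norm_num), zpow_add₀ hq0 (binom2 n - n), sub_neg_eq_add,
    show binom2 n - 2 * n + 3 = binom2 n - n + (3 - n) by ring, zpow_add₀ hq0 (binom2 n - n),
    show q ^ binom2 n = q ^ (binom2 n - n) * q ^ n by rw [← zpow_add₀ hq0]; congr 1; ring]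
  ring

/-! ### Identification with Appell series -/

/-- Reducing a theta argument modulo the period becomes three integer identities: one for the
argument, one for the parity of the sign (with witness $c$), one for the exponent of $q$. -/
lemma monomial_mul_Theta {q : ℂ} (hq0 : q ≠ 0) (hq1 : ‖q‖ < 1) {N : ℕ} (hN : N ≠ 0)
    {s e k : ℤ} (M j p g c : ℤ) (hk : k = N * M + j) (hs : s + M = p + 2 * c)
    (hg : e - N * binom2 M - j * M = g) :
    (-1) ^ s * q ^ e * Theta (q ^ k) (q ^ N) = (-1) ^ p * q ^ g * Theta (q ^ j) (q ^ N) := by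
  have e1 : (-1 : ℂ) ^ s * (-1) ^ M = (-1) ^ p := by
    rw [← zpow_add₀ (by norm_num)]
    exact neg_one_zpow_congr c hs
  have e2 : q ^ e * q ^ (-(N * binom2 M) - j * M) = q ^ g := by
    rw [← zpow_add₀ hq0, ← hg]
    congr 1
    ring
  rw [hk, Theta_zpow_add hq0 hq1 hN, ← e1, ← e2]
  ring

lemma summable_appellTerm {q X Z : ℂ} (hq0 : q ≠ 0) (hq1 : ‖q‖ < 1) {N : ℕ} (hN : N ≠ 0)
    (hZ : Z ≠ 0) (h : ∀ r : ℤ, ∃ n : ℤ, (q ^ N) ^ (r - 1) * X * Z = -q ^ n) :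
    Summable (appellTerm X Z (q ^ N)) := by
  have h1 : 0 < 1 - ‖q‖ := by linarith
  refine Summable.of_norm_bounded ((summable_norm_thetaTerm (pow_ne_zero N hq0)
    (norm_pow_lt_one hq1 hN) hZ).div_const (1 - ‖q‖)) fun r => ?_
  obtain ⟨n, hn⟩ := h r
  rw [appellTerm, hn, sub_neg_eq_add, ← thetaTerm, norm_div]
  gcongr
  exact one_sub_norm_le_norm_one_add_zpow hq0 hq1 n

lemma appellTerm_three_denom {q x : ℂ} (hq0 : q ≠ 0) (hx : x ≠ 0) (k : ℕ) (r : ℤ) :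
    (q ^ 3) ^ (r - 1) * (x ^ (-3 : ℤ) * q ^ k) * (-x ^ 3) = -q ^ (3 * r - 3 + k) := by
  have e1 : x ^ (-3 : ℤ) * x ^ 3 = 1 := by
    rw [← zpow_natCast x 3, ← zpow_add₀ hx]
    simp
  have e2 : (q ^ 3) ^ (r - 1) * q ^ k = q ^ (3 * r - 3 + k) := by
    rw [pow_zpow_eq, ← zpow_natCast q k, ← zpow_add₀ hq0]
    congr 1
    push_cast
    ring
  rw [← e2]
  linear_combination -(q ^ 3) ^ (r - 1) * q ^ k * e1

lemma appellTerm_four_denom {q x : ℂ} (hq0 : q ≠ 0) (hx : x ≠ 0) (k s : ℕ) (r : ℤ) :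
    (q ^ 4) ^ (r - 1) * (-x ^ (-4 : ℤ) * q ^ k) * (q ^ s * x ^ 4) = -q ^ (4 * r - 4 + k + s) := by
  have e1 : x ^ (-4 : ℤ) * x ^ 4 = 1 := by
    rw [← zpow_natCast x 4, ← zpow_add₀ hx]
    simp
  have e2 : (q ^ 4) ^ (r - 1) * q ^ k * q ^ s = q ^ (4 * r - 4 + k + s) := by
    rw [pow_zpow_eq, ← zpow_natCast q k, ← zpow_natCast q s, ← zpow_add₀ hq0, ← zpow_add₀ hq0]
    congr 1
    push_cast
    ring
  rw [← e2]
  linear_combination -(q ^ 4) ^ (r - 1) * q ^ k * q ^ s * e1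

lemma appellTerm_three {q x : ℂ} (hq0 : q ≠ 0) (hx : x ≠ 0) (k : ℕ) (r : ℤ) :
    appellTerm (x ^ (-3 : ℤ) * q ^ k) (-x ^ 3) (q ^ 3) r =
      q ^ (3 * binom2 r) * x ^ (3 * r) / (1 + q ^ (3 * r - 3 + k)) := by
  have e : (-1 : ℂ) ^ r * (-1) ^ r = 1 := by rw [← mul_zpow]; simp
  rw [appellTerm, appellTerm_three_denom hq0 hx, sub_neg_eq_add, neg_zpow_eq (x ^ 3),
    pow_zpow_eq, pow_zpow_eq]
  congr 1
  push_cast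
  linear_combination q ^ (3 * binom2 r) * x ^ (3 * r) * e

lemma appellTerm_four {q x : ℂ} (hq0 : q ≠ 0) (hx : x ≠ 0) (k s : ℕ) (r : ℤ) :
    appellTerm (-x ^ (-4 : ℤ) * q ^ k) (q ^ s * x ^ 4) (q ^ 4) r =
      (-1) ^ r * q ^ (4 * binom2 r + s * r) * x ^ (4 * r) / (1 + q ^ (4 * r - 4 + k + s)) := by
  rw [appellTerm, appellTerm_four_denom hq0 hx, sub_neg_eq_add, mul_zpow, pow_zpow_eq,
    pow_zpow_eq, pow_zpow_eq, zpow_add₀ hq0 (4 * binom2 r)]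
  push_cast
  ring

lemma summable_appellTerm_three {q x : ℂ} (hq0 : q ≠ 0) (hq1 : ‖q‖ < 1) (hx : x ≠ 0) (k : ℕ) :
    Summable (appellTerm (x ^ (-3 : ℤ) * q ^ k) (-x ^ 3) (q ^ 3)) :=
  summable_appellTerm hq0 hq1 (by norm_num) (neg_ne_zero.2 (pow_ne_zero 3 hx))
    fun r => ⟨_, appellTerm_three_denom hq0 hx k r⟩

lemma summable_appellTerm_four {q x : ℂ} (hq0 : q ≠ 0) (hq1 : ‖q‖ < 1) (hx : x ≠ 0)
    (k s : ℕ) : Summable (appellTerm (-x ^ (-4 : ℤ) * q ^ k) (q ^ s * x ^ 4) (q ^ 4)) :=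
  summable_appellTerm hq0 hq1 (by norm_num) (mul_ne_zero (pow_ne_zero s hq0) (pow_ne_zero 4 hx))
    fun r => ⟨_, appellTerm_four_denom hq0 hx k s r⟩

/-- The series in the Appell functions of base `q ^ 3`. -/
noncomputable def appellSumThree (q x : ℂ) (k : ℕ) : ℂ :=
  ∑' r, appellTerm (x ^ (-3 : ℤ) * q ^ k) (-x ^ 3) (q ^ 3) r

/-- The series in the Appell functions of base `q ^ 4`. -/
noncomputable def appellSumFour (q x : ℂ) (k s : ℕ) : ℂ :=
  ∑' r, appellTerm (-x ^ (-4 : ℤ) * q ^ k) (q ^ s * x ^ 4) (q ^ 4) r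

lemma hasSum_coeffThree {q x : ℂ} (hq0 : q ≠ 0) (hq1 : ‖q‖ < 1) (hx : x ≠ 0) :
    HasSum (fun n : ℤ => x ^ n * coeffThree q n)
      (x ^ (-2 : ℤ) * qPoch q q * appellSumThree q x 1 +
        x ^ (-1 : ℤ) * qPoch q q * appellSumThree q x 2) := by
  have hA := fun k => (summable_appellTerm_three hq0 hq1 hx k).hasSum
  -- The added zero is the contribution of the class $3\mid n$. The representatives $3m-2,3m-1,3m$
  -- all have $\lceil n/3\rceil=m$.
  rw [← add_zero (_ + _)]
  refine hasSum_of_residues_three (((hA 1).mul_left _).congr_fun fun m => ?_)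
    (((hA 2).mul_left _).congr_fun fun m => ?_) (hasSum_zero.congr_fun fun m => ?_)
  · have hb : binom2 (3 * m - 2) = 9 * binom2 m - 3 * m + 3 :=
      binom2_eq_of_two_mul (by linear_combination 9 * two_mul_binom2 m)
    have hb' : binom2 (2 - 2 * m) = 4 * binom2 m - m + 1 :=
      binom2_eq_of_two_mul (by linear_combination 4 * two_mul_binom2 m)
    have ha : -(-(3 * m - 2) / 3) = m := by omega
    have hT := monomial_mul_Theta hq0 hq1 (N := 3) (by norm_num)
      (s := 3 * m - 2 + m) (e := binom2 (3 * m - 2) - (3 * m - 2) + (3 * m - 2) * m)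
      (2 - 2 * m) 1 0 (3 * binom2 m) m (k := 3 - 2 * (3 * m - 2)) (by push_cast; ring) (by ring)
      (by
        rw [hb, hb']
        push_cast
        linear_combination -3 * two_mul_binom2 m)
    rw [coeffThree, ha, hT, zpow_one, Theta_self_pow_three hq0 hq1, appellTerm_three hq0 hx,
      show x ^ (3 * m - 2) = x ^ (-2 : ℤ) * x ^ (3 * m) by rw [← zpow_add₀ hx]; congr 1; ring,
      show 3 * m - 3 + ((1 : ℕ) : ℤ) = 3 * m - 2 by push_cast; ring]
    ring
  · have hb : binom2 (3 * m - 1) = 9 * binom2 m + 1 :=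
      binom2_eq_of_two_mul (by linear_combination 9 * two_mul_binom2 m)
    have hb' : binom2 (1 - 2 * m) = 4 * binom2 m + m :=
      binom2_eq_of_two_mul (by linear_combination 4 * two_mul_binom2 m)
    have ha : -(-(3 * m - 1) / 3) = m := by omega
    have hT := monomial_mul_Theta hq0 hq1 (N := 3) (by norm_num)
      (s := 3 * m - 1 + m) (e := binom2 (3 * m - 1) - (3 * m - 1) + (3 * m - 1) * m)
      (1 - 2 * m) 2 0 (3 * binom2 m) m (k := 3 - 2 * (3 * m - 1)) (by push_cast; ring) (by ring)
      (by
        rw [hb, hb']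
        push_cast
        linear_combination -3 * two_mul_binom2 m)
    rw [coeffThree, ha, hT, Theta_zpow_two_pow_three hq0 hq1, appellTerm_three hq0 hx,
      show x ^ (3 * m - 1) = x ^ (-1 : ℤ) * x ^ (3 * m) by rw [← zpow_add₀ hx]; congr 1; ring,
      show 3 * m - 3 + ((2 : ℕ) : ℤ) = 3 * m - 1 by push_cast; ring]
    ring
  · have hT := Theta_zpow_add hq0 hq1 (N := 3) (by norm_num) (1 - 2 * m) 0
    rw [zpow_zero, Theta_one, mul_zero] at hT
    rw [coeffThree, show 3 - 2 * (3 * m) = ((3 : ℕ) : ℤ) * (1 - 2 * m) + 0 by push_cast; ring, hT]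
    ring

lemma hasSum_coeffFour {q x : ℂ} (hq0 : q ≠ 0) (hq1 : ‖q‖ < 1) (hx : x ≠ 0) :
    HasSum (fun n : ℤ => x ^ n * coeffFour q n)
      (x ^ (-3 : ℤ) * Theta (q ^ 6) (q ^ 12) * appellSumFour q x 1 0 +
        (-(x ^ (-2 : ℤ) * Theta (q ^ 3) (q ^ 12)) * appellSumFour q x 1 1 +
          q ^ 3 * x ^ 2 * Theta (q ^ (-3 : ℤ)) (q ^ 12) * appellSumFour q x 3 3) +
        -(x ^ (-1 : ℤ) * Theta (q ^ 6) (q ^ 12)) * appellSumFour q x 3 0 +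
        (Theta (q ^ 3) (q ^ 12) * appellSumFour q x 3 1 +
          -(q ^ 3 * Theta (q ^ (-3 : ℤ)) (q ^ 12)) * appellSumFour q x 1 3)) := by
  have hA := fun k s => (summable_appellTerm_four hq0 hq1 hx k s).hasSum
  -- For $k=s=3$ the denominator at index $r$ is $1+q^{4r+2}$, so $r=m-1$ is needed to meet the
  -- class $n=4m-2$.
  have hA' := (Equiv.subRight (1 : ℤ)).hasSum_iff.2 (hA 3 3)
  have hT := fun {s e : ℤ} (k M j p g c : ℤ) =>
    monomial_mul_Theta hq0 hq1 (N := 12) (by norm_num) (s := s) (e := e) (k := k) M j p g c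
  have hb1 : ∀ m, binom2 (1 - m) = binom2 m := fun m =>
    binom2_eq_of_two_mul (by linear_combination two_mul_binom2 m)
  have hb2 : ∀ m, binom2 (2 - m) = binom2 m - m + 1 := fun m =>
    binom2_eq_of_two_mul (by linear_combination two_mul_binom2 m)
  have hs : ∀ m : ℤ, (-1 : ℂ) ^ (m + 1) = -(-1) ^ m := fun m => by
    rw [zpow_add₀ (by norm_num), zpow_one, mul_neg_one]
  refine hasSum_of_residues_four (((hA 1 0).mul_left _).congr_fun fun m => ?_)
    ((((hA 1 1).mul_left _).add (hA'.mul_left _)).congr_fun fun m => ?_)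
    (((hA 3 0).mul_left _).congr_fun fun m => ?_)
    ((((hA 3 1).mul_left _).add ((hA 1 3).mul_left _)).congr_fun fun m => ?_)
  · have hb : binom2 (4 * m - 3) = 16 * binom2 m - 6 * m + 6 :=
      binom2_eq_of_two_mul (by linear_combination 16 * two_mul_binom2 m)
    rw [coeffFour, hT (9 - 3 * (4 * m - 3)) (1 - m) 6 m (4 * binom2 m) (m - 1) (by push_cast; ring) (by ring)
        (by rw [hb, hb1]; push_cast; ring),
      hT (15 - 3 * (4 * m - 3)) (2 - m) 0 (m + 1) (4 * binom2 m - 2 * m + 3) (m - 1) (by push_cast; ring) (by ring)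
        (by rw [hb, hb2]; push_cast; ring),
      zpow_zero, Theta_one, appellTerm_four hq0 hx,
      show x ^ (4 * m - 3) = x ^ (-3 : ℤ) * x ^ (4 * m) by rw [← zpow_add₀ hx]; congr 1; ring,
      show 4 * m - 4 + ((1 : ℕ) : ℤ) + ((0 : ℕ) : ℤ) = 4 * m - 3 by push_cast; ring,
      Nat.cast_zero, zero_mul, add_zero, show q ^ (6 : ℤ) = q ^ 6 from rfl]
    ring
  · have hb : binom2 (4 * m - 2) = 16 * binom2 m - 2 * m + 3 :=
      binom2_eq_of_two_mul (by linear_combination 16 * two_mul_binom2 m)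
    have hb3 : binom2 (m - 1) = binom2 m - m + 1 :=
      binom2_eq_of_two_mul (by linear_combination two_mul_binom2 m)
    have hx4 : x ^ (4 * (m - 1)) * x ^ 2 = x ^ (-2 : ℤ) * x ^ (4 * m) := by
      rw [← zpow_natCast x 2, ← zpow_add₀ hx, ← zpow_add₀ hx]
      congr 1
      push_cast
      ring
    have hq4 : q ^ 3 * q ^ (4 * binom2 (m - 1) + ((3 : ℕ) : ℤ) * (m - 1)) =
        q ^ (4 * binom2 m - m + 4) := by
      rw [← zpow_natCast q 3, ← zpow_add₀ hq0, hb3]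
      congr 1
      push_cast
      ring
    have hs' : (-1 : ℂ) ^ (m - 1) = -(-1) ^ m := by
      rw [zpow_sub₀ (by norm_num), zpow_one, div_neg, div_one]
    rw [coeffFour, hT (9 - 3 * (4 * m - 2)) (1 - m) 3 (m + 1) (4 * binom2 m + m) (m - 1) (by push_cast; ring) (by ring)
        (by rw [hb, hb1]; push_cast; ring),
      hT (15 - 3 * (4 * m - 2)) (2 - m) (-3) m (4 * binom2 m - m + 4) m (by push_cast; ring) (by ring)
        (by rw [hb, hb2]; push_cast; ring),
      Function.comp, Equiv.subRight_apply, appellTerm_four hq0 hx, appellTerm_four hq0 hx, hs, hs',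
      show x ^ (4 * m - 2) = x ^ (-2 : ℤ) * x ^ (4 * m) by rw [← zpow_add₀ hx]; congr 1; ring,
      show 4 * m - 4 + ((1 : ℕ) : ℤ) + ((1 : ℕ) : ℤ) = 4 * m - 2 by push_cast; ring,
      show 4 * (m - 1) - 4 + ((3 : ℕ) : ℤ) + ((3 : ℕ) : ℤ) = 4 * m - 2 by push_cast; ring,
      show q ^ (3 : ℤ) = q ^ 3 from rfl, ← hx4, ← hq4, Nat.cast_one, one_mul]
    linear_combination -(-1) ^ m * q ^ (4 * binom2 m + m) * Theta (q ^ 3) (q ^ 12) /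
      (1 + q ^ (4 * m - 2)) * hx4
  · have hb : binom2 (4 * m - 1) = 16 * binom2 m + 2 * m + 1 :=
      binom2_eq_of_two_mul (by linear_combination 16 * two_mul_binom2 m)
    rw [coeffFour, hT (9 - 3 * (4 * m - 1)) (1 - m) 0 m (4 * binom2 m + 2 * m + 1) m (by push_cast; ring) (by ring)
        (by rw [hb, hb1]; push_cast; ring),
      hT (15 - 3 * (4 * m - 1)) (1 - m) 6 m (4 * binom2 m) m (by push_cast; ring) (by ring)
        (by rw [hb, hb1]; push_cast; ring),
      zpow_zero, Theta_one, appellTerm_four hq0 hx,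
      show x ^ (4 * m - 1) = x ^ (-1 : ℤ) * x ^ (4 * m) by rw [← zpow_add₀ hx]; congr 1; ring,
      show 4 * m - 4 + ((3 : ℕ) : ℤ) + ((0 : ℕ) : ℤ) = 4 * m - 1 by push_cast; ring,
      Nat.cast_zero, zero_mul, add_zero, show q ^ (6 : ℤ) = q ^ 6 from rfl]
    ring
  · have hb : binom2 (4 * m) = 16 * binom2 m + 6 * m :=
      binom2_eq_of_two_mul (by linear_combination 16 * two_mul_binom2 m)
    have hq4 : q ^ (4 * binom2 m + 3 * m + 3) = q ^ 3 * q ^ (4 * binom2 m + 3 * m) := by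
      rw [← zpow_natCast q 3, ← zpow_add₀ hq0]
      congr 1
      push_cast
      ring
    rw [coeffFour, hT (9 - 3 * (4 * m)) (1 - m) (-3) (m + 1) (4 * binom2 m + 3 * m + 3) m (by push_cast; ring)
        (by ring) (by rw [hb, hb1]; push_cast; ring),
      hT (15 - 3 * (4 * m)) (1 - m) 3 (m + 1) (4 * binom2 m + m) m (by push_cast; ring) (by ring)
        (by rw [hb, hb1]; push_cast; ring),
      appellTerm_four hq0 hx, appellTerm_four hq0 hx, hs, hq4,
      show 4 * m - 4 + ((3 : ℕ) : ℤ) + ((1 : ℕ) : ℤ) = 4 * m by push_cast; ring,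
      show 4 * m - 4 + ((1 : ℕ) : ℤ) + ((3 : ℕ) : ℤ) = 4 * m by push_cast; ring,
      show q ^ (3 : ℤ) = q ^ 3 from rfl, Nat.cast_one, one_mul,
      show ((3 : ℕ) : ℤ) = 3 from rfl]
    ring

/-- Both sides are sums of the same family over $n$ at the given $x$, so uniqueness of sums suffices
and no comparison of Laurent coefficients is needed. -/
lemma hecke_mul_Theta {q x : ℂ} (hq0 : q ≠ 0) (hq1 : ‖q‖ < 1) (hx : x ≠ 0) :
    hecke 1 2 3 (x⁻¹ * q ^ 2) (q ^ 3) q * Theta (-x ^ 3) (q ^ 3) =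
      x ^ (-2 : ℤ) * qPoch q q * appellSumThree q x 1 +
      x ^ (-1 : ℤ) * qPoch q q * appellSumThree q x 2 +
      (x ^ (-3 : ℤ) * Theta (q ^ 6) (q ^ 12) * appellSumFour q x 1 0 +
        (-(x ^ (-2 : ℤ) * Theta (q ^ 3) (q ^ 12)) * appellSumFour q x 1 1 +
          q ^ 3 * x ^ 2 * Theta (q ^ (-3 : ℤ)) (q ^ 12) * appellSumFour q x 3 3) +
        -(x ^ (-1 : ℤ) * Theta (q ^ 6) (q ^ 12)) * appellSumFour q x 3 0 +
        (Theta (q ^ 3) (q ^ 12) * appellSumFour q x 3 1 +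
          -(q ^ 3 * Theta (q ^ (-3 : ℤ)) (q ^ 12)) * appellSumFour q x 1 3)) :=
  (hasSum_hecke_mul_Theta hq0 hq1 hx).unique
    (((hasSum_coeffThree hq0 hq1 hx).add (hasSum_coeffFour hq0 hq1 hx)).congr_fun
      fun _ => mul_add _ _ _)

end AppellForm

theorem proposition7p1 (q x : ℂ) (hq0 : q ≠ 0) (hq1 : ‖q‖ < 1) (hx : x ≠ 0)
    (h3 : AppellForm.Theta (-x ^ 3) (q ^ 3) ≠ 0)
    (h4 : ∀ s ∈ ({0, 1, 3} : Set ℕ), AppellForm.Theta (q ^ s * x ^ 4) (q ^ 4) ≠ 0) :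
    Summable (AppellForm.heckeTerm 1 2 3 (x⁻¹ * q ^ 2) (q ^ 3) q) ∧
    (∀ k ∈ ({1, 2} : Set ℕ),
      Summable (AppellForm.appellTerm (x ^ (-3 : ℤ) * q ^ k) (-x ^ 3) (q ^ 3))) ∧
    (∀ k ∈ ({1, 3} : Set ℕ), ∀ s ∈ ({0, 1, 3} : Set ℕ),
      Summable (AppellForm.appellTerm (-x ^ (-4 : ℤ) * q ^ k) (q ^ s * x ^ 4) (q ^ 4))) ∧
    AppellForm.hecke 1 2 3 (x⁻¹ * q ^ 2) (q ^ 3) q =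
      x⁻¹ * AppellForm.appell (x ^ (-3 : ℤ) * q ^ 2) (-x ^ 3) (q ^ 3) * AppellForm.qPoch q q
      + x ^ (-2 : ℤ) * AppellForm.appell (x ^ (-3 : ℤ) * q) (-x ^ 3) (q ^ 3) *
          AppellForm.qPoch q q
      + x⁻¹ * (AppellForm.Theta (q ^ 6) (q ^ 12) * AppellForm.Theta (x ^ 4) (q ^ 4) /
            AppellForm.Theta (-x ^ 3) (q ^ 3)) *
          (x ^ (-2 : ℤ) * AppellForm.appell (-x ^ (-4 : ℤ) * q) (x ^ 4) (q ^ 4)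
            - AppellForm.appell (-x ^ (-4 : ℤ) * q ^ 3) (x ^ 4) (q ^ 4))
      - AppellForm.Theta (q ^ 3) (q ^ 12) * AppellForm.Theta (q * x ^ 4) (q ^ 4) /
            AppellForm.Theta (-x ^ 3) (q ^ 3) *
          (x ^ (-2 : ℤ) * AppellForm.appell (-x ^ (-4 : ℤ) * q) (q * x ^ 4) (q ^ 4)
            - AppellForm.appell (-x ^ (-4 : ℤ) * q ^ 3) (q * x ^ 4) (q ^ 4))
      - q ^ 3 * x ^ 2 * (AppellForm.Theta (q ^ (-3 : ℤ)) (q ^ 12) *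
            AppellForm.Theta (q ^ 3 * x ^ 4) (q ^ 4) / AppellForm.Theta (-x ^ 3) (q ^ 3)) *
          (x ^ (-2 : ℤ) * AppellForm.appell (-x ^ (-4 : ℤ) * q) (q ^ 3 * x ^ 4) (q ^ 4)
            - AppellForm.appell (-x ^ (-4 : ℤ) * q ^ 3) (q ^ 3 * x ^ 4) (q ^ 4)) := by
  refine ⟨(AppellForm.summable_norm_heckeTerm hq0 hq1
      (mul_ne_zero (inv_ne_zero hx) (pow_ne_zero 2 hq0)) (pow_ne_zero 3 hq0)).of_norm,
    fun k _ => AppellForm.summable_appellTerm_three hq0 hq1 hx k,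
    fun k _ s _ => AppellForm.summable_appellTerm_four hq0 hq1 hx k s, ?_⟩
  have hthree : ∀ k, AppellForm.appell (x ^ (-3 : ℤ) * q ^ k) (-x ^ 3) (q ^ 3) =
      (AppellForm.Theta (-x ^ 3) (q ^ 3))⁻¹ * AppellForm.appellSumThree q x k := fun _ => rfl
  have hfour : ∀ k s, AppellForm.appell (-x ^ (-4 : ℤ) * q ^ k) (q ^ s * x ^ 4) (q ^ 4) =
      (AppellForm.Theta (q ^ s * x ^ 4) (q ^ 4))⁻¹ * AppellForm.appellSumFour q x k s :=
    fun _ _ => rfl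
  have a1 := hthree 1
  have a2 := hthree 2
  have b10 := hfour 1 0
  have b30 := hfour 3 0
  have b11 := hfour 1 1
  have b31 := hfour 3 1
  have b13 := hfour 1 3
  have b33 := hfour 3 3
  have t0 := h4 0 (by simp)
  have t1 := h4 1 (by simp)
  have t3 := h4 3 (by simp)
  simp only [pow_zero, one_mul, pow_one] at a1 b10 b30 b11 b31 b13 t0 t1
  rw [a1, a2, b10, b30, b11, b31, b13, b33]
  -- After clearing $\Theta(-x^3;q^3)$, each base $q^4$ theta prefactor cancels the normalisation of
  -- its Appell function; this uses the nonvanishing for $s=0,1,3$.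
  apply mul_right_cancel₀ h3
  rw [AppellForm.hecke_mul_Theta hq0 hq1 hx, show x ^ (-1 : ℤ) = x⁻¹ by simp,
    show x ^ (-2 : ℤ) = (x⁻¹) ^ 2 by simp [zpow_neg],
    show x ^ (-3 : ℤ) = (x⁻¹) ^ 3 by simp [zpow_neg]]
  generalize AppellForm.Theta (q ^ (-3 : ℤ)) (q ^ 12) = T
  generalize AppellForm.Theta (-x ^ 3) (q ^ 3) = A at *
  generalize AppellForm.Theta (x ^ 4) (q ^ 4) = B0 at *
  generalize AppellForm.Theta (q * x ^ 4) (q ^ 4) = B1 at *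
  generalize AppellForm.Theta (q ^ 3 * x ^ 4) (q ^ 4) = B3 at *
  field_simp
  ring
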